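/- Let $X$ be a nonempty set and let $\mathbb{Z}\langle X\rangle$ be the free $\mathbb{Z}$-module on the set $X^*$ of words in the alphabet $X$, graded by the length of words. For words $u=(x_1\cdots x_r)$ and $v=(x_{r+1}\cdots x_{r+t})$, the shuffle product is $u\sqcup\!\sqcup v=\sum_\sigma (x_{\sigma^{-1}(1)}\cdots x_{\sigma^{-1}(r+t)})\in\mathbb{Z}\langle X\rangle$, where $\sigma$ ranges over the permutations of $1,\dots,r+t$ with $\sigma(1)<\cdots<\sigma(r)$ and $\sigma(r+1)<\cdots<\sigma(r+t)$; that is, the sum, with multiplicities, of all interleavings of $u$ and $v$. Let $M\subseteq\mathbb{Z}\langle X\rangle$ be the submodule generated by all $u\sqcup\!\sqcup v$ with $u,v$ nonempty words, let $\mathrm{Sh}_{\mathbb Z}(X)_{\mathrm{indec}}=\mathbb{Z}\langle X\rangle/M$ be the indecomposable quotient of the shuffle algebra, and let $\mathrm{Sh}_{\mathbb Z}(X)_{\mathrm{indec},s}$ be its homogeneous component of degree $s$, i.e. the image of the span of the words of length $s$. For integers $s,m\ge 1$ put $$\varphi_s(m)=\frac1s\sum_{d\mid s}\mu(d)\,m^{s/d},$$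 where $\mu$ is the Möbius function, and put $\varphi_s(\infty)=\infty$. Then for every prime number $p$ and every integer $s$ with $1\le s<p$, $$\dim_{\mathbb{F}_p}\bigl(\mathrm{Sh}_{\mathbb Z}(X)_{\mathrm{indec},s}\otimes_{\mathbb Z}\mathbb{Z}/p\bigr)=\varphi_s(|X|).$$ (Infinite cardinalities and dimensions are all denoted by $\infty$.) Moreover, for every total order on $X$, $\varphi_s(|X|)$ is the number of Lyndon words of length $s$ over $X$, that is, of the nonempty words of length $s$ which are smaller, in the alphabetical order, than each of their nonempty proper suffixes. -/

import Mathlib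

open scoped TensorProduct

namespace ShuffleAlgebra

/-- The free `ℤ`-module `ℤ⟨X⟩` on the set `X*` of words in the alphabet `X`; words are lists. -/
abbrev Words (X : Type*) : Type _ := List X →₀ ℤ

/-- The shuffle product `u ⧢ v ∈ ℤ⟨X⟩` of two words: the sum, with multiplicities, of all the
interleavings of `u` and `v`, sorted by their first letter. -/
noncomputable def shuffle {X : Type*} : List X → List X → Words X
  | [], v => Finsupp.single v 1
  | a :: u, [] => Finsupp.single (a :: u) 1
  | a :: u, b :: v =>
      (shuffle u (b :: v)).mapDomain (List.cons a) + (shuffle (a :: u) v).mapDomain (List.cons b)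
termination_by u v => u.length + v.length

/-- The submodule of `ℤ⟨X⟩` generated by the shuffle products of two nonempty words. -/
noncomputable def decomposable (X : Type*) : Submodule ℤ (Words X) :=
  Submodule.span ℤ {f | ∃ u v : List X, u ≠ [] ∧ v ≠ [] ∧ f = shuffle u v}

/-- The indecomposable quotient of the shuffle algebra. -/
abbrev Indec (X : Type*) : Type _ := Words X ⧸ decomposable X

/-- The homogeneous component of degree `s` of `ℤ⟨X⟩`, generated by the words of length `s`. -/
noncomputable def wordsDeg (X : Type*) (s : ℕ) : Submodule ℤ (Words X) :=
  Finsupp.supported ℤ ℤ {w : List X | w.length = s}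

/-- The homogeneous component of degree `s` of the indecomposable quotient, i.e. the image of
the homogeneous component of degree `s` of `ℤ⟨X⟩`. -/
noncomputable def indecDeg (X : Type*) (s : ℕ) : Submodule ℤ (Indec X) :=
  (wordsDeg X s).map (decomposable X).mkQ

/-- Witt's necklace function `φ_s(m) = (1/s) ∑_{d ∣ s} μ(d) m^{s/d}`, with `φ_s(∞) = ∞`. -/
noncomputable def necklace (s : ℕ) (m : ℕ∞) : WithTop ℚ :=
  m.map fun k : ℕ =>
    (1 / (s : ℚ)) * ∑ d ∈ s.divisors, (ArithmeticFunction.moebius d : ℚ) * (k : ℚ) ^ (s / d)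

/-- A Lyndon word: a nonempty word which is smaller, in the alphabetical order, than each of its
nonempty proper suffixes. -/
def IsLyndon {X : Type*} [LinearOrder X] (w : List X) : Prop :=
  w ≠ [] ∧ ∀ v : List X, v <:+ w → v ≠ [] → v ≠ w → w < v

/-- The set of the Lyndon words of length `s` over `X`. -/
def lyndonWords (X : Type*) [LinearOrder X] (s : ℕ) : Set (List X) :=
  {w | IsLyndon w ∧ w.length = s}

end ShuffleAlgebra

namespace ShuffleAlgebra

/-! The classes of the Lyndon words of length `s` form a basis modulo `p` when `X` is finite.

Spanning: a non-Lyndon word factors as a nonincreasing product of at least two Lyndon words. Let `v`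
be the last factor and `u` the product of the others. Then `u ++ v` is the largest word of `u ⧢ v`
(`Interleaving.le_append`), and its coefficient lies between 1 and `s`
(`exists_shuffle_of_not_isLyndon`). It is invertible modulo `p` because `s < p`, so the word can be
rewritten through smaller ones.

Independence: bracketing a Lyndon word along its standard factorization gives a primitive series,
which kills all decomposables, with that word as least term and coefficient 1
(`exists_primitive_hasLeading`). These forms are triangular on Lyndon words. Their products also
yield the coefficient bound above.

Counting: every nonempty word is uniquely a rotation of a power of a Lyndon word
(`sum_divisors_mul_ncard_lyndonWords`), and Möbius inversion gives the necklace formula. For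
infinite `X`, independence and infinitely many Lyndon words suffice. -/

theorem append_flatten_comm {X : Type*} {v : List X} {M : List (List X)} (h : ∀ m ∈ M, m = v) :
    v ++ M.flatten = M.flatten ++ v := by
  induction M with
  | nil => simp
  | cons m M ih =>
    obtain rfl := h m (by simp)
    rw [List.flatten_cons, List.append_assoc, ← ih fun x hx => h x (by simp [hx])]

/-! ### Alphabetical order and concatenation -/

section Order

variable {X : Type*} [LinearOrder X]

theorem cons_le_cons_iff {a b : X} {x y : List X} :
    a :: x ≤ b :: y ↔ a < b ∨ a = b ∧ x ≤ y := by
  rw [← not_lt, List.cons_lt_cons_iff, ← not_lt (b := x)]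
  rcases lt_trichotomy a b with h | rfl | h
  · simp [h, h.not_gt, h.ne']
  · simp
  · simp [h, h.not_gt, h.ne']

/-- The comparison is decided at a letter inside both words, so the tails are irrelevant. -/
theorem append_lt_append_of_not_prefix {x y : List X} (h : x < y) (hp : ¬ x <+: y)
    (s t : List X) : x ++ s < y ++ t := by
  induction x generalizing y with
  | nil => exact absurd (List.nil_prefix) hp
  | cons a x ih =>
    cases y with
    | nil => exact absurd h (List.not_lt_nil _)
    | cons b y =>
      rw [List.cons_lt_cons_iff] at h
      rw [List.cons_append, List.cons_append, List.cons_lt_cons_iff]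
      rcases h with h | ⟨rfl, h⟩
      · exact Or.inl h
      · exact Or.inr ⟨rfl, ih h fun h' => hp (by simpa using h')⟩

theorem append_lt_append_of_length_le {x y : List X} (h : x < y) (hl : y.length ≤ x.length)
    (s t : List X) : x ++ s < y ++ t :=
  append_lt_append_of_not_prefix h (fun hp => h.ne (hp.eq_of_length_le hl)) s t

theorem append_lt_append_iff_right (x : List X) {s t : List X} : x ++ s < x ++ t ↔ s < t := by
  induction x with
  | nil => rfl
  | cons a x ih => simp [ih]

theorem le_append_self (x s : List X) : x ≤ x ++ s := by
  induction x with
  | nil => exact not_lt.1 (List.not_lt_nil _)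
  | cons a x ih => simpa [cons_le_cons_iff] using ih

theorem IsLyndon.le_suffix {l x : List X} (hl : IsLyndon l) (hx : x <:+ l) (h0 : x ≠ []) :
    l ≤ x := by
  by_cases h : x = l
  · exact h.ge
  · exact (hl.2 x hx h0 h).le

end Order

/-! ### Interleavings and their largest word -/

section Interleavings

variable {X : Type*}

/-- `Interleaving u v z` says that `z` is an interleaving of the words `u` and `v`. -/
inductive Interleaving : List X → List X → List X → Prop
  | nil : Interleaving [] [] []
  | left (a : X) {u v z : List X} : Interleaving u v z → Interleaving (a :: u) v (a :: z)
  | right (b : X) {u v z : List X} : Interleaving u v z → Interleaving u (b :: v) (b :: z)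

theorem Interleaving.nil_left : ∀ v : List X, Interleaving [] v v
  | [] => .nil
  | b :: v => .right b (nil_left v)

theorem Interleaving.append : ∀ u v : List X, Interleaving u v (u ++ v)
  | [], v => nil_left v
  | a :: u, v => .left a (append u v)

theorem Interleaving.nil_right : ∀ u : List X, Interleaving u [] u
  | [] => .nil
  | a :: u => .left a (nil_right u)

theorem Interleaving.eq_of_nil_left {v z : List X} (h : Interleaving [] v z) : z = v := by
  induction v generalizing z with
  | nil => cases h; rfl
  | cons b v ih => cases h with | right _ h => rw [ih h]

theorem Interleaving.length_eq {u v z : List X} (h : Interleaving u v z) :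
    z.length = u.length + v.length := by
  induction h with
  | nil => rfl
  | left a _ ih => simp [ih]; omega
  | right b _ ih => simp [ih]; omega

theorem interleaving_of_shuffle_ne_zero (u v : List X) :
    ∀ z, shuffle u v z ≠ 0 → Interleaving u v z := by
  induction u, v using shuffle.induct with
  | case1 v =>
    intro z hz
    rw [shuffle] at hz
    rw [Finsupp.single_apply_ne_zero] at hz
    rw [hz.1]; exact .nil_left v
  | case2 a u =>
    intro z hz
    rw [shuffle] at hz
    rw [Finsupp.single_apply_ne_zero] at hz
    rw [hz.1]; exact .nil_right _
  | case3 a u b v ih1 ih2 =>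
    intro z hz
    rw [shuffle, Finsupp.add_apply] at hz
    by_cases h1 : (shuffle u (b :: v)).mapDomain (List.cons a) z = 0
    · rw [h1, zero_add] at hz
      obtain ⟨y, hy, rfl⟩ : z ∈ List.cons b '' ((shuffle (a :: u) v).support : Set (List X)) := by
        by_contra hc
        exact hz (Finsupp.mapDomain_of_not_mem_image_support hc)
      exact .right b (ih2 y (by simpa using hy))
    · obtain ⟨y, hy, rfl⟩ : z ∈ List.cons a '' ((shuffle u (b :: v)).support : Set (List X)) := by
        by_contra hc
        exact h1 (Finsupp.mapDomain_of_not_mem_image_support hc)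
      exact .left a (ih1 y (by simpa using hy))

variable [LinearOrder X]

/-- An exchange argument: `x` is a delayed prefix handed over from the first word to the second. If
the next letter comes from `v` and equals the first letter of `u`, it is read from `u` instead and
the letter of `v` joins `x`. If it is smaller than the first letter of `u`, any interleaving that
starts with `u` wins. -/
theorem Interleaving.exists_le_of_append_left {U v z : List X} (h : Interleaving U v z) :
    ∀ x u : List X, U = x ++ u → v ≤ u → ∃ y, z ≤ y ∧ Interleaving u (x ++ v) y := by
  induction h with
  | nil =>
    intro x u hU _
    obtain ⟨rfl, rfl⟩ := List.append_eq_nil_iff.1 hU.symm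
    exact ⟨[], le_rfl, .nil⟩
  | @left a U v z h ih =>
    intro x u hU hv
    cases x with
    | nil =>
      obtain rfl : a :: U = u := hU
      exact ⟨_, le_rfl, .left a h⟩
    | cons c x =>
      obtain ⟨rfl, rfl⟩ : a = c ∧ U = x ++ u := by simpa using hU
      obtain ⟨y, hy, hi⟩ := ih x u rfl hv
      exact ⟨a :: y, by simpa [cons_le_cons_iff] using hy, .right a hi⟩
  | @right b U v z h ih =>
    rintro x u rfl hv
    cases u with
    | nil => exact absurd (List.nil_lt_cons b v) (not_lt.2 hv)
    | cons c u =>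
      rw [ShuffleAlgebra.cons_le_cons_iff] at hv
      rcases hv with hv | ⟨rfl, hv⟩
      · exact ⟨_, (List.cons_lt_cons_iff.2 (Or.inl hv)).le, .append _ _⟩
      · obtain ⟨y, hy, hi⟩ := ih (x ++ [b]) u (by simp) hv
        refine ⟨b :: y, by simpa [cons_le_cons_iff] using hy, .left b ?_⟩
        simpa using hi

/-- If `v` is at most every nonempty suffix of `u`, then `u ++ v` is the largest interleaving of
`u` and `v`. -/
theorem Interleaving.le_append {u v z : List X} (h : Interleaving u v z)
    (huv : ∀ x, x <:+ u → x ≠ [] → v ≤ x) : z ≤ u ++ v := by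
  induction u generalizing z with
  | nil => exact h.eq_of_nil_left.le
  | cons a u ih =>
    have ih' := fun {z} (h : Interleaving u v z) =>
      ih h fun x hx => huv x (hx.trans (List.suffix_cons a u))
    have hv := huv _ (List.suffix_refl _) (List.cons_ne_nil a u)
    cases h with
    | left _ h => simpa [cons_le_cons_iff] using ih' h
    | @right b _ v z h =>
      rw [ShuffleAlgebra.cons_le_cons_iff] at hv
      rcases hv with hv | ⟨rfl, hv⟩
      · exact (List.cons_lt_cons_iff.2 (Or.inl hv)).le
      · obtain ⟨y, hy, hi⟩ := h.exists_le_of_append_left [b] u rfl hv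
        have := hy.trans (ih' hi)
        simpa [cons_le_cons_iff] using this

end Interleavings

/-! ### Primitive series and the pairing with shuffles -/

section Pairing

variable {X : Type*}

/-- The sum of `F x y` over all the factorizations `w = x ++ y`. -/
def splitSum (F : List X → List X → ℤ) : List X → ℤ
  | [] => F [] []
  | a :: w => F [] (a :: w) + splitSum (fun x y => F (a :: x) y) w

/-- The concatenation product of two functions on words, seen as noncommutative series. -/
def conv (f g : List X → ℤ) (w : List X) : ℤ := splitSum (fun x y => f x * g y) w

/-- The value on `u ⧢ v` of the linear form on `ℤ⟨X⟩` given by a function on words. -/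
noncomputable def shufflePair (f : List X → ℤ) (u v : List X) : ℤ :=
  Finsupp.linearCombination ℤ f (shuffle u v)

theorem splitSum_add (F G : List X → List X → ℤ) (w : List X) :
    splitSum (fun x y => F x y + G x y) w = splitSum F w + splitSum G w := by
  induction w generalizing F G with
  | nil => rfl
  | cons a w ih => simp only [splitSum, ih]; ring

theorem splitSum_zero (w : List X) : splitSum (fun _ _ => 0) w = 0 := by
  induction w with
  | nil => rfl
  | cons a w ih => simp only [splitSum, ih]; rfl

theorem splitSum_congr {F G : List X → List X → ℤ} {w : List X}
    (h : ∀ x y, x ++ y = w → F x y = G x y) : splitSum F w = splitSum G w := by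
  induction w generalizing F G with
  | nil => exact h _ _ rfl
  | cons a w ih =>
    simp only [splitSum]
    rw [h [] (a :: w) rfl, ih fun x y hxy => h (a :: x) y (by simp [hxy])]

/-- If only the prefix `x` contributes, then so does only one factorization. -/
theorem splitSum_append {F : List X → List X → ℤ} (x y : List X)
    (h : ∀ x' y', x'.length ≠ x.length → F x' y' = 0) : splitSum F (x ++ y) = F x y := by
  induction x generalizing F with
  | nil =>
    cases y with
    | nil => rfl
    | cons b y =>
      have := splitSum_congr (w := y) (F := fun x y => F (b :: x) y) (G := fun _ _ => 0)
        fun x' y' _ => h _ _ (by simp)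
      simp [splitSum, this, splitSum_zero]
  | cons a x ih =>
    simp only [List.cons_append, splitSum]
    rw [h [] _ (by simp), zero_add,
      ih fun x' y' hx => h (a :: x') y' (by simpa using hx)]

theorem splitSum_eq_zero {F : List X → List X → ℤ} {w : List X}
    (h : ∀ x y, x ++ y = w → F x y = 0) : splitSum F w = 0 :=
  (splitSum_congr h).trans (splitSum_zero w)

/-- If only the suffix `y = []` contributes, then so does only the trivial factorization. -/
theorem splitSum_of_right {F : List X → List X → ℤ} (w : List X)
    (h : ∀ x y, y ≠ [] → F x y = 0) : splitSum F w = F w [] := by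
  induction w generalizing F with
  | nil => rfl
  | cons a w ih =>
    simp only [splitSum]
    rw [h [] _ (by simp), zero_add, ih fun x y hy => h (a :: x) y hy]

theorem shufflePair_nil_left (f : List X → ℤ) (v : List X) : shufflePair f [] v = f v := by
  simp [shufflePair, shuffle]

theorem shufflePair_nil_right (f : List X → ℤ) (u : List X) : shufflePair f u [] = f u := by
  cases u <;> simp [shufflePair, shuffle]

theorem shufflePair_cons_cons (f : List X → ℤ) (a b : X) (u v : List X) :
    shufflePair f (a :: u) (b :: v) = shufflePair (fun w => f (a :: w)) u (b :: v) +
      shufflePair (fun w => f (b :: w)) (a :: u) v := by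
  simp only [shufflePair]
  rw [shuffle, map_add, Finsupp.linearCombination_mapDomain, Finsupp.linearCombination_mapDomain]
  rfl

theorem shufflePair_add (f g : List X → ℤ) (u v : List X) :
    shufflePair (fun w => f w + g w) u v = shufflePair f u v + shufflePair g u v := by
  simp only [shufflePair, Finsupp.linearCombination_apply, smul_add, Finsupp.sum_add]

theorem shufflePair_sub (f g : List X → ℤ) (u v : List X) :
    shufflePair (fun w => f w - g w) u v = shufflePair f u v - shufflePair g u v := by
  simp only [shufflePair, Finsupp.linearCombination_apply, smul_sub, Finsupp.sum_sub]

theorem shufflePair_mul_left (c : ℤ) (g : List X → ℤ) (u v : List X) :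
    shufflePair (fun w => c * g w) u v = c * shufflePair g u v := by
  simp only [shufflePair, Finsupp.linearCombination_apply, Finsupp.sum, Finset.mul_sum,
    smul_eq_mul]
  exact Finset.sum_congr rfl fun _ _ => by ring

/-- Deconcatenation is multiplicative for the shuffle product. -/
theorem shufflePair_conv (f g : List X → ℤ) (u v : List X) :
    shufflePair (conv f g) u v = splitSum (fun u₁ u₂ =>
      splitSum (fun v₁ v₂ => shufflePair f u₁ v₁ * shufflePair g u₂ v₂) v) u := by
  induction u generalizing f v with
  | nil => simp only [shufflePair_nil_left, splitSum, conv]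
  | cons a u ihu =>
    induction v generalizing f with
    | nil => simp only [shufflePair_nil_right, splitSum, conv]
    | cons b v ihv =>
      have hc (c : X) : (fun w => conv f g (c :: w)) =
          fun w => f [] * g (c :: w) + conv (fun x => f (c :: x)) g w := rfl
      rw [shufflePair_cons_cons, hc, hc, shufflePair_add, shufflePair_add, shufflePair_mul_left,
        shufflePair_mul_left, ihu, ihv]
      simp only [splitSum, shufflePair_cons_cons, shufflePair_nil_left, shufflePair_nil_right,
        add_mul, splitSum_add]
      ring

/-- A function on words is a primitive series if the corresponding linear form vanishes on the
empty word and on the shuffle products of nonempty words. -/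
def IsPrimitive (f : List X → ℤ) : Prop :=
  f [] = 0 ∧ ∀ u v, u ≠ [] → v ≠ [] → shufflePair f u v = 0

/-- In the deconcatenation formula, primitivity of `f` kills every term in which `u₁` and `v₁` are
both nonempty or both empty. -/
theorem IsPrimitive.shufflePair_conv {f : List X → ℤ} (hf : IsPrimitive f) (g : List X → ℤ)
    (u v : List X) :
    shufflePair (conv f g) u v = splitSum (fun x y => f x * shufflePair g y v) u +
      splitSum (fun x y => f x * shufflePair g u y) v := by
  have key (u₁ u₂ : List X) (h : u₁ ≠ []) :
      splitSum (fun v₁ v₂ => shufflePair f u₁ v₁ * shufflePair g u₂ v₂) v =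
        f u₁ * shufflePair g u₂ v := by
    rw [← List.nil_append v, splitSum_append, shufflePair_nil_right]
    · rfl
    · intro x y hx
      rw [hf.2 _ _ h (by rintro rfl; exact hx rfl), zero_mul]
  rw [ShuffleAlgebra.shufflePair_conv]
  cases u with
  | nil => simp [splitSum, hf.1, shufflePair_nil_left]
  | cons a u =>
    simp only [splitSum, hf.1, shufflePair_nil_left]
    rw [splitSum_congr fun x y _ => key (a :: x) y (by simp)]
    ring

/-- On nonempty `u`, `v` the product of two primitive series takes the value `f u * g v + f v * g
u`, which is symmetric in `f` and `g`. -/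
theorem IsPrimitive.conv_sub_conv {f g : List X → ℤ} (hf : IsPrimitive f) (hg : IsPrimitive g) :
    IsPrimitive fun w => conv f g w - conv g f w := by
  have key {f g : List X → ℤ} (hf : IsPrimitive f) (hg : IsPrimitive g) (u v : List X)
      (hu : u ≠ []) (hv : v ≠ []) : shufflePair (conv f g) u v = f u * g v + f v * g u := by
    rw [hf.shufflePair_conv, splitSum_of_right, splitSum_of_right, shufflePair_nil_left,
      shufflePair_nil_right]
    · intro x y hy
      rw [hg.2 _ _ hu hy, mul_zero]
    · intro x y hy
      rw [hg.2 _ _ hy hv, mul_zero]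
  refine ⟨by simp [conv, splitSum, hf.1], fun u v hu hv => ?_⟩
  rw [shufflePair_sub, key hf hg u v hu hv, key hg hf u v hu hv]
  ring

theorem shufflePair_eq_zero {f : List X → ℤ} {u v : List X}
    (h : ∀ z, Interleaving u v z → f z = 0) : shufflePair f u v = 0 := by
  rw [shufflePair, Finsupp.linearCombination_apply]
  refine Finset.sum_eq_zero fun z hz => ?_
  have := h z (interleaving_of_shuffle_ne_zero u v z (Finsupp.mem_support_iff.1 hz))
  simp [this]

end Pairing

/-! ### Lyndon factorizations -/

section Factorization

variable {X : Type*} [LinearOrder X]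

theorem exists_min_suffix (w : List X) (hw : w ≠ []) :
    ∃ v, v <:+ w ∧ v ≠ [] ∧ ∀ x, x <:+ w → x ≠ [] → v ≤ x := by
  induction w with
  | nil => exact absurd rfl hw
  | cons a w ih =>
    by_cases h : w = []
    · subst h
      refine ⟨[a], List.suffix_refl _, hw, fun x hx h0 => ?_⟩
      rcases List.suffix_cons_iff.1 hx with h | h
      · exact h.ge
      · exact absurd (List.suffix_nil.1 h) h0
    · obtain ⟨v, hv, h0, hmin⟩ := ih h
      rcases le_total v (a :: w) with hle | hle
      · refine ⟨v, hv.trans (List.suffix_cons a w), h0, fun x hx hx0 => ?_⟩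
        rcases List.suffix_cons_iff.1 hx with rfl | hx
        · exact hle
        · exact hmin x hx hx0
      · refine ⟨a :: w, List.suffix_refl _, hw, fun x hx hx0 => ?_⟩
        rcases List.suffix_cons_iff.1 hx with rfl | hx
        · exact le_rfl
        · exact hle.trans (hmin x hx hx0)

theorem isLyndon_of_le_suffix {v : List X} (h0 : v ≠ [])
    (h : ∀ x, x <:+ v → x ≠ [] → v ≤ x) : IsLyndon v :=
  ⟨h0, fun x hx hx0 hne => lt_of_le_of_ne (h x hx hx0) (Ne.symm hne)⟩

/-- If `x < v` and `x` is not a prefix of `v`, then `x ++ v < v`, against minimality. If `v = x ++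
y`, minimality gives both `v ≤ y` and `y ≤ v`, impossible by length. -/
theorem le_suffix_of_min_suffix {u v : List X} (h0 : v ≠ [])
    (hmin : ∀ x, x <:+ u ++ v → x ≠ [] → v ≤ x) (x : List X) (hx : x <:+ u) (hx0 : x ≠ []) :
    v ≤ x := by
  by_contra! hlt
  obtain ⟨t, rfl⟩ := hx
  have h1 := hmin (x ++ v) ⟨t, by simp⟩ (by simp [h0])
  by_cases hp : x <+: v
  · obtain ⟨y, rfl⟩ := hp
    have hy0 : y ≠ [] := by
      rintro rfl
      exact absurd hlt (by simp)
    have h2 := hmin y ⟨t ++ x ++ x, by simp⟩ hy0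
    have h3 := not_lt.2 h1
    rw [append_lt_append_iff_right, not_lt] at h3
    have h4 := congrArg List.length (le_antisymm h2 h3)
    have := List.length_pos_iff.2 hx0
    rw [List.length_append] at h4
    omega
  · have := append_lt_append_of_not_prefix hlt hp v []
    rw [List.append_nil] at this
    exact absurd h1 (not_le.2 this)

/-- A factorization of a nonempty word into a nonincreasing product of Lyndon words, the last of
which is the smallest suffix. -/
theorem exists_lyndon_factorization (n : ℕ) : ∀ w : List X, w.length ≤ n → w ≠ [] →
    ∃ (M : List (List X)) (v : List X), (∀ l ∈ M ++ [v], IsLyndon l) ∧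
      (M ++ [v]).Pairwise (fun a b => b ≤ a) ∧ M.flatten ++ v = w ∧
      ∀ x, x <:+ M.flatten → x ≠ [] → v ≤ x := by
  induction n with
  | zero => exact fun w hn h0 => absurd (List.length_eq_zero_iff.1 (Nat.le_zero.1 hn)) h0
  | succ n ih =>
    intro w hn h0
    obtain ⟨v, ⟨u, rfl⟩, hv0, hmin⟩ := exists_min_suffix w h0
    have hv : IsLyndon v :=
      isLyndon_of_le_suffix hv0 fun x hx => hmin x (hx.trans (List.suffix_append u v))
    have hs := le_suffix_of_min_suffix hv0 hmin
    by_cases hu : u = []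
    · subst hu
      exact ⟨[], v, by simpa using hv, by simp, rfl, hs⟩
    · have hl : u.length ≤ n := by
        have := List.length_pos_iff.2 hv0
        simp at hn
        omega
      obtain ⟨M, m, hL, hM, rfl, -⟩ := ih u hl hu
      refine ⟨M ++ [m], v, ?_, ?_, by simp, by simpa using hs⟩
      · intro l hl
        rcases List.mem_append.1 hl with h | h
        · exact hL l h
        · rw [List.mem_singleton.1 h]; exact hv
      · have hm : v ≤ m := hs m (List.suffix_append _ _) (hL m (by simp)).1
        refine List.pairwise_append.2 ⟨hM, by simp, fun a ha b hb => ?_⟩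
        rw [List.mem_singleton.1 hb]
        rcases List.mem_append.1 ha with h | h
        · exact hm.trans ((List.pairwise_append.1 hM).2.2 a h m (by simp))
        · rw [List.mem_singleton.1 h]; exact hm

/-- The standard factorization of a Lyndon word of length at least two. -/
theorem IsLyndon.exists_standard_factorization {l : List X} (hl : IsLyndon l)
    (h2 : 2 ≤ l.length) :
    ∃ x y, x ++ y = l ∧ IsLyndon x ∧ IsLyndon y ∧ l < y ++ x := by
  obtain ⟨a, t, rfl⟩ := List.exists_cons_of_ne_nil hl.1
  have ht : t ≠ [] := by rintro rfl; simp at h2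
  -- The right factor is the least proper suffix.
  obtain ⟨y, hyt, hy0, hmin⟩ := exists_min_suffix t ht
  have hy : IsLyndon y := isLyndon_of_le_suffix hy0 fun x hx => hmin x (hx.trans hyt)
  obtain ⟨t', rfl⟩ := hyt
  have hly : a :: (t' ++ y) < y := hl.2 y ⟨a :: t', rfl⟩ hy0 fun h => by
    have := congrArg List.length h
    simp at this
    omega
  refine ⟨a :: t', y, rfl, ⟨by simp, fun x hx hx0 hne => ?_⟩, hy, hly.trans_le (le_append_self _ _)⟩
  have hxt : x <:+ t' := (List.suffix_cons_iff.1 hx).resolve_left hne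
  have hlen := hxt.length_le
  obtain ⟨r, hr⟩ := hxt
  have h1 : a :: (t' ++ y) < x ++ y := by
    refine hl.2 _ ⟨a :: r, by simp [← hr]⟩ (by simp [hx0]) fun h => ?_
    have := congrArg List.length h
    simp at this
    omega
  by_contra hc
  have hlt : x < a :: t' := lt_of_le_of_ne (not_lt.1 hc) hne
  -- If the left factor is `x ++ z`, cancelling `x` in `h1` gives `z ++ y < y`, although `y` is the
  -- least proper suffix.
  by_cases hp : x <+: a :: t'
  · obtain ⟨z, hz⟩ := hp
    have h3 : y < z ++ y := by
      rw [← List.cons_append, ← hz, List.append_assoc, append_lt_append_iff_right] at h1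
      exact absurd h1 (not_lt.2 (hmin _ (by
        have h4 : z ++ y <:+ a :: (t' ++ y) := ⟨x, by rw [← List.append_assoc, hz]; rfl⟩
        refine (List.suffix_cons_iff.1 h4).resolve_left fun h => ?_
        have h5 := congrArg List.length h
        have h6 := congrArg List.length hz
        have := List.length_pos_iff.2 hx0
        simp at h5 h6
        omega) (by simp [hy0])))
    rw [← List.cons_append, ← hz, List.append_assoc, append_lt_append_iff_right] at h1
    exact lt_asymm h1 h3
  · exact lt_asymm h1 (append_lt_append_of_not_prefix hlt hp y y)

end Factorization

/-! ### Leading words and the coefficient bound -/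

section Leading

variable {X : Type*} [LinearOrder X]

/-- A series `f` has the leading word `w` if it is `w` plus a combination of larger words of the
same length. -/
def HasLeading (f : List X → ℤ) (w : List X) : Prop :=
  f w = 1 ∧ ∀ z, f z ≠ 0 → z.length = w.length ∧ w ≤ z

theorem append_le_append {x x' y y' : List X} (hl : x'.length = x.length) (hx : x ≤ x')
    (hy : y ≤ y') : x ++ y ≤ x' ++ y' := by
  rcases hx.eq_or_lt with rfl | hx
  · exact not_lt.1 fun h => not_lt.2 hy ((append_lt_append_iff_right _).1 h)
  · exact (append_lt_append_of_length_le hx hl.le _ _).le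

theorem HasLeading.conv {f g : List X → ℤ} {x y : List X} (hf : HasLeading f x)
    (hg : HasLeading g y) : HasLeading (conv f g) (x ++ y) := by
  constructor
  · rw [ShuffleAlgebra.conv, splitSum_append, hf.1, hg.1, one_mul]
    intro x' y' h
    rw [not_not.1 fun h' => h (hf.2 x' h').1, zero_mul]
  · intro z hz
    obtain ⟨x', y', rfl, h⟩ : ∃ x' y', x' ++ y' = z ∧ f x' * g y' ≠ 0 := by
      by_contra! hc
      exact hz (splitSum_eq_zero hc)
    obtain ⟨hx, hx'⟩ := hf.2 x' (left_ne_zero_of_mul h)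
    obtain ⟨hy, hy'⟩ := hg.2 y' (right_ne_zero_of_mul h)
    exact ⟨by simp [hx, hy], append_le_append hx hx' hy'⟩

/-- The bracketing of a Lyndon word is a primitive series led by this word. -/
theorem exists_primitive_hasLeading (n : ℕ) : ∀ l : List X, l.length ≤ n → IsLyndon l →
    ∃ f, IsPrimitive f ∧ HasLeading f l := by
  induction n with
  | zero => exact fun l hn hl => absurd (List.length_eq_zero_iff.1 (Nat.le_zero.1 hn)) hl.1
  | succ n ih =>
    intro l hn hl
    by_cases h2 : 2 ≤ l.length
    · obtain ⟨x, y, rfl, hx, hy, hlt⟩ := hl.exists_standard_factorization h2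
      have hx0 := List.length_pos_iff.2 hx.1
      have hy0 := List.length_pos_iff.2 hy.1
      rw [List.length_append] at hn
      obtain ⟨f, hf, hfx⟩ := ih x (by omega) hx
      obtain ⟨g, hg, hgy⟩ := ih y (by omega) hy
      have hfg := hfx.conv hgy
      have hgf := hgy.conv hfx
      refine ⟨_, hf.conv_sub_conv hg, ?_, fun z hz => ?_⟩
      · beta_reduce
        -- The opposite product starts at `y ++ x`, beyond the Lyndon word, so it does not disturb
        -- the leading term.
        rw [hfg.1, not_not.1 fun h => not_le.2 hlt (hgf.2 _ h).2, sub_zero]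
      · by_cases h : conv f g z = 0
        · beta_reduce at hz
          rw [h, zero_sub, neg_ne_zero] at hz
          obtain ⟨h1, h2⟩ := hgf.2 z hz
          exact ⟨by rw [h1]; simp [add_comm], hlt.le.trans h2⟩
        · exact hfg.2 z h
    · obtain ⟨a, rfl⟩ : ∃ a, l = [a] :=
        List.length_eq_one_iff.1 (by have := List.length_pos_iff.2 hl.1; omega)
      refine ⟨fun w => if w = [a] then 1 else 0, ⟨by simp, fun u v hu hv => ?_⟩, by simp, ?_⟩
      · refine shufflePair_eq_zero fun z hz => if_neg ?_
        rintro rfl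
        have := hz.length_eq
        have := List.length_pos_iff.2 hu
        have := List.length_pos_iff.2 hv
        simp at *
        omega
      · intro z hz
        obtain rfl : z = [a] := by by_contra h; exact hz (if_neg h)
        exact ⟨rfl, le_rfl⟩

open Classical in
/-- A primitive series with the given leading word, if this word is Lyndon. -/
noncomputable def lyndonSeries (l : List X) : List X → ℤ :=
  if h : ∃ f, IsPrimitive f ∧ HasLeading f l then h.choose else 0

theorem IsLyndon.lyndonSeries_spec {l : List X} (hl : IsLyndon l) :
    IsPrimitive (lyndonSeries l) ∧ HasLeading (lyndonSeries l) l := by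
  have h := exists_primitive_hasLeading _ l le_rfl hl
  rw [lyndonSeries, dif_pos h]
  exact h.choose_spec

/-- The product of the primitive series of a list of Lyndon words. -/
noncomputable def lyndonProd : List (List X) → List X → ℤ
  | [] => fun w => if w = [] then 1 else 0
  | l :: L => conv (lyndonSeries l) (lyndonProd L)

theorem hasLeading_lyndonProd (L : List (List X)) (hL : ∀ l ∈ L, IsLyndon l) :
    HasLeading (lyndonProd L) L.flatten := by
  induction L with
  | nil =>
    refine ⟨by simp [lyndonProd], fun z hz => ?_⟩
    obtain rfl : z = [] := by by_contra h; exact hz (if_neg h)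
    exact ⟨rfl, le_rfl⟩
  | cons l L ih =>
    exact (hL l (by simp)).lyndonSeries_spec.2.conv (ih fun m hm => hL m (by simp [hm]))

/-- The pairing is the number of factors of `M ++ [v]` equal to `v`. Peeling off the primitive
factor of `l`, the part inside `l ++ M.flatten` returns the previous value; the part inside `v`
needs a prefix of `v` that is at least `l ≥ v`, so it adds 1 exactly when `l = v`. -/
theorem shufflePair_lyndonProd (M : List (List X)) (v : List X)
    (hL : ∀ l ∈ M ++ [v], IsLyndon l) (hM : (M ++ [v]).Pairwise (fun a b => b ≤ a)) :
    0 < shufflePair (lyndonProd (M ++ [v])) M.flatten v ∧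
      shufflePair (lyndonProd (M ++ [v])) M.flatten v ≤ M.length + 1 := by
  induction M with
  | nil =>
    have := (hasLeading_lyndonProd [v] (by simpa using hL)).1
    simp only [List.flatten_cons, List.flatten_nil, List.append_nil] at this
    simp [shufflePair_nil_left, this]
  | cons l M ih =>
    have hL' : ∀ m ∈ M ++ [v], IsLyndon m := fun m hm => hL m (List.mem_cons_of_mem _ hm)
    rw [List.cons_append, List.pairwise_cons] at hM
    obtain ⟨h1, h2⟩ := ih hL' hM.2
    obtain ⟨hp, hl⟩ := (hL l (by simp)).lyndonSeries_spec
    have hvl : v ≤ l := hM.1 v (by simp)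
    have hs : splitSum (fun x y => lyndonSeries l x *
        shufflePair (lyndonProd (M ++ [v])) (l ++ M.flatten) y) v = if l = v then 1 else 0 := by
      split_ifs with h
      · subst h
        have hn := splitSum_append (F := fun x y => lyndonSeries l x *
          shufflePair (lyndonProd (M ++ [l])) (l ++ M.flatten) y) l []
        rw [List.append_nil] at hn
        -- By monotonicity all factors equal `l`, so moving `l` to the end gives the leading word.
        rw [hn, hl.1, one_mul, shufflePair_nil_right,
          append_flatten_comm]
        · simpa using (hasLeading_lyndonProd (M ++ [l]) hL').1
        · intro m hm
          exact le_antisymm (hM.1 m (by simp [hm])) ((List.pairwise_append.1 hM.2).2.2 m hm l (by simp))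
        · intro x y hx
          rw [not_not.1 fun h' => hx (hl.2 x h').1, zero_mul]
      · refine splitSum_eq_zero fun x y hxy => ?_
        have h0 : lyndonSeries l x = 0 := by
          by_contra hne
          refine h (le_antisymm ((hl.2 x hne).2.trans ?_) hvl)
          rw [← hxy]
          exact le_append_self x y
        rw [h0, zero_mul]
    have key : shufflePair (lyndonProd (l :: (M ++ [v]))) (l ++ M.flatten) v =
        shufflePair (lyndonProd (M ++ [v])) M.flatten v + if l = v then 1 else 0 := by
      rw [lyndonProd, hp.shufflePair_conv, hs, splitSum_append, hl.1, one_mul]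
      intro x y hx
      rw [not_not.1 fun h' => hx (hl.2 x h').1, zero_mul]
    rw [List.cons_append, List.flatten_cons, key, List.length_cons]
    push_cast
    split_ifs <;> constructor <;> omega

/-- A word which is not Lyndon is the largest word of a shuffle product of nonempty words, where
its coefficient is positive and at most its length. -/
theorem exists_shuffle_of_not_isLyndon (w : List X) (h0 : w ≠ []) (hw : ¬ IsLyndon w) :
    ∃ u v, u ≠ [] ∧ v ≠ [] ∧ 0 < shuffle u v w ∧ shuffle u v w ≤ w.length ∧
      ∀ z, shuffle u v z ≠ 0 → z.length = w.length ∧ z ≤ w := by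
  obtain ⟨M, v, hL, hM, rfl, hs⟩ := exists_lyndon_factorization _ w le_rfl h0
  have hv : IsLyndon v := hL v (by simp)
  have hu : M.flatten ≠ [] := by
    intro h
    rw [h] at hw
    exact hw hv
  have hz (z : List X) (hz : shuffle M.flatten v z ≠ 0) :
      z.length = (M.flatten ++ v).length ∧ z ≤ M.flatten ++ v := by
    have := interleaving_of_shuffle_ne_zero _ _ z hz
    exact ⟨by rw [this.length_eq, List.length_append], this.le_append hs⟩
  have hlen : M.length + 1 ≤ (M.flatten ++ v).length := by
    have h1 : M.length ≤ M.flatten.length := by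
      have : ∀ l ∈ M, 1 ≤ l.length := fun l hl =>
        List.length_pos_iff.2 (hL l (by simp [hl])).1
      clear * - this
      induction M with
      | nil => simp
      | cons m M ih =>
        have h1 := this m (by simp)
        have h2 := ih fun l hl => this l (by simp [hl])
        simp only [List.length_cons, List.flatten_cons, List.length_append]
        omega
    have := List.length_pos_iff.2 hv.1
    rw [List.length_append]
    omega
  have hlead := hasLeading_lyndonProd _ hL
  rw [List.flatten_append, List.flatten_cons, List.flatten_nil, List.append_nil] at hlead
  -- The words of the shuffle are at most `M.flatten ++ v` and those of the series at least that, so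
  -- only this word contributes.
  have hc : shufflePair (lyndonProd (M ++ [v])) M.flatten v = shuffle M.flatten v (M.flatten ++ v) := by
    rw [shufflePair, Finsupp.linearCombination_apply, Finsupp.sum,
      Finset.sum_eq_single (M.flatten ++ v), hlead.1, smul_eq_mul, mul_one]
    · intro z hz' hne
      rw [not_not.1 fun h => hne (le_antisymm (hz z (Finsupp.mem_support_iff.1 hz')).2
        (hlead.2 z h).2), smul_zero]
    · intro h
      rw [Finsupp.notMem_support_iff.1 h, zero_smul]
  obtain ⟨h1, h2⟩ := shufflePair_lyndonProd M v hL hM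
  rw [hc] at h1 h2
  exact ⟨M.flatten, v, hu, hv.1, h1, h2.trans (by exact_mod_cast hlen), hz⟩

end Leading

/-! ### Lyndon words as a basis modulo `p` -/

section Module

variable {X : Type*} {s : ℕ}

theorem mkQ_mem_indecDeg {g : Words X} (hg : g ∈ wordsDeg X s) :
    (decomposable X).mkQ g ∈ indecDeg X s :=
  Submodule.mem_map_of_mem hg

open Classical in
/-- The class of a word of length `s` in the component of degree `s` of the indecomposable
quotient, extended by zero to all words. -/
noncomputable def wordClass (s : ℕ) (w : List X) : indecDeg X s :=
  if h : w.length = s then ⟨_, mkQ_mem_indecDeg (Finsupp.single_mem_supported ℤ 1 h)⟩ else 0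

theorem coe_wordClass {w : List X} (h : w.length = s) :
    (wordClass s w : Indec X) = (decomposable X).mkQ (Finsupp.single w 1) := by
  rw [wordClass, dif_pos h]

theorem coe_linearCombination_wordClass {g : Words X} (hg : g ∈ wordsDeg X s) :
    (Finsupp.linearCombination ℤ (wordClass s) g : Indec X) = (decomposable X).mkQ g := by
  conv_rhs => rw [← Finsupp.sum_single g]
  rw [Finsupp.linearCombination_apply, Finsupp.sum, Finsupp.sum, Submodule.coe_sum, map_sum]
  refine Finset.sum_congr rfl fun w hw => ?_
  have hl : w.length = s := (Finsupp.mem_supported ℤ g).1 hg hw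
  rw [Submodule.coe_smul, coe_wordClass hl, ← map_smul, Finsupp.smul_single, smul_eq_mul, mul_one]

theorem span_range_tmul_wordClass (p : ℕ) :
    Submodule.span (ZMod p) (Set.range fun w : {w : List X // w.length = s} =>
      (1 : ZMod p) ⊗ₜ[ℤ] wordClass s w.1) = ⊤ := by
  rw [eq_top_iff]
  rintro x -
  induction x with
  | zero => exact zero_mem _
  | add x y hx hy => exact add_mem hx hy
  | tmul a x =>
    rw [← mul_one a, ← smul_eq_mul, ← TensorProduct.smul_tmul']
    refine Submodule.smul_mem _ _ ?_
    obtain ⟨x, g, hg, rfl⟩ := x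
    have : (⟨(decomposable X).mkQ g, ⟨g, hg, rfl⟩⟩ : indecDeg X s) =
        Finsupp.linearCombination ℤ (wordClass s) g :=
      Subtype.ext (coe_linearCombination_wordClass hg).symm
    rw [this, Finsupp.linearCombination_apply, Finsupp.sum, TensorProduct.tmul_sum]
    refine Submodule.sum_mem _ fun w hw => ?_
    rw [TensorProduct.tmul_smul]
    have hl : w.length = s := (Finsupp.mem_supported ℤ g).1 hg hw
    exact zsmul_mem (Submodule.subset_span
      (Set.mem_range_self (⟨w, hl⟩ : {w : List X // w.length = s}))) _

theorem sum_shuffle_tmul_wordClass (p : ℕ) {u v : List X} (hu : u ≠ []) (hv : v ≠ [])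
    (hs : shuffle u v ∈ wordsDeg X s) :
    ∑ z ∈ (shuffle u v).support,
      (shuffle u v z : ZMod p) • ((1 : ZMod p) ⊗ₜ[ℤ] wordClass s z) = 0 := by
  have h0 : Finsupp.linearCombination ℤ (wordClass s) (shuffle u v) = 0 := by
    refine Subtype.ext ?_
    rw [coe_linearCombination_wordClass hs, ZeroMemClass.coe_zero, Submodule.mkQ_apply,
      Submodule.Quotient.mk_eq_zero]
    exact Submodule.subset_span ⟨u, v, hu, hv, rfl⟩
  have h1 := congrArg (fun x => (1 : ZMod p) ⊗ₜ[ℤ] x) h0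
  simp only [TensorProduct.tmul_zero] at h1
  rw [Finsupp.linearCombination_apply, Finsupp.sum, TensorProduct.tmul_sum] at h1
  rw [← h1]
  refine Finset.sum_congr rfl fun z _ => ?_
  rw [TensorProduct.tmul_smul, Int.cast_smul_eq_zsmul]

/-- The linear form on the component of degree `s` of the indecomposable quotient, modulo `p`,
given by a primitive series. -/
theorem IsPrimitive.exists_linearMap {f : List X → ℤ} (hf : IsPrimitive f) (p s : ℕ) :
    ∃ φ : ZMod p ⊗[ℤ] indecDeg X s →ₗ[ZMod p] ZMod p,
      ∀ w : List X, w.length = s → φ (1 ⊗ₜ wordClass s w) = (f w : ZMod p) := by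
  have hker : decomposable X ≤ LinearMap.ker (Finsupp.linearCombination ℤ f) := by
    rw [decomposable, Submodule.span_le]
    rintro _ ⟨u, v, hu, hv, rfl⟩
    exact hf.2 u v hu hv
  let ψ : indecDeg X s →ₗ[ℤ] ℤ :=
    ((decomposable X).liftQ _ hker).comp (indecDeg X s).subtype
  refine ⟨(TensorProduct.AlgebraTensorModule.rid ℤ (ZMod p) (ZMod p)).toLinearMap.comp
    (ψ.baseChange (ZMod p)), fun w hw => ?_⟩
  have hψ : ψ (wordClass s w) = f w := by
    change (decomposable X).liftQ _ hker (wordClass s w : Indec X) = f w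
    rw [coe_wordClass hw, Submodule.mkQ_apply, Submodule.liftQ_apply]
    simp
  simp [hψ]

variable [LinearOrder X]

theorem span_range_tmul_lyndonWords [Finite X] (p : ℕ) [Fact p.Prime] (hs : 1 ≤ s) (hsp : s < p) :
    Submodule.span (ZMod p) (Set.range fun w : lyndonWords X s =>
      (1 : ZMod p) ⊗ₜ[ℤ] wordClass s w.1) = ⊤ := by
  rw [eq_top_iff, ← span_range_tmul_wordClass, Submodule.span_le]
  rintro _ ⟨w, rfl⟩
  -- Finiteness makes the order on words of length `s` well founded.
  have : Finite {w : List X // w.length = s} := (List.finite_length_eq X s).to_subtype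
  induction w using WellFoundedLT.induction with
  | ind w ih =>
  obtain ⟨w, hw⟩ := w
  by_cases hl : IsLyndon w
  · exact Submodule.subset_span ⟨⟨w, hl, hw⟩, rfl⟩
  · obtain ⟨u, v, hu, hv, h1, h2, h3⟩ :=
      exists_shuffle_of_not_isLyndon w (List.length_pos_iff.1 (by omega)) hl
    have hsum := sum_shuffle_tmul_wordClass (s := s) p hu hv
      ((Finsupp.mem_supported ℤ _).2 fun z hz =>
        (h3 z (Finsupp.mem_support_iff.1 hz)).1.trans hw)
    rw [← Finset.add_sum_erase _ _ (Finsupp.mem_support_iff.2 h1.ne')] at hsum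
    -- The coefficient lies between 1 and `s`, and `s < p`.
    have hc : (shuffle u v w : ZMod p) ≠ 0 := by
      rw [Ne, ZMod.intCast_zmod_eq_zero_iff_dvd]
      intro hd
      have := Int.le_of_dvd h1 hd
      omega
    have hmem : (shuffle u v w : ZMod p) • ((1 : ZMod p) ⊗ₜ[ℤ] wordClass s w) ∈
        Submodule.span (ZMod p) (Set.range fun w : lyndonWords X s =>
          (1 : ZMod p) ⊗ₜ[ℤ] wordClass s w.1) := by
      rw [eq_neg_of_add_eq_zero_left hsum]
      refine neg_mem (Submodule.sum_mem _ fun z hz => Submodule.smul_mem _ _ ?_)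
      obtain ⟨hne, hz⟩ := Finset.mem_erase.1 hz
      obtain ⟨hlen, hle⟩ := h3 z (Finsupp.mem_support_iff.1 hz)
      exact ih ⟨z, hlen.trans hw⟩ (lt_of_le_of_ne hle fun h => hne (congrArg Subtype.val h))
    exact (Submodule.smul_mem_iff _ hc).1 hmem

/-- The series of the largest word in a relation vanishes on all smaller words, so it isolates that
word's coefficient. -/
theorem linearIndependent_tmul_lyndonWords (p : ℕ) [Fact p.Prime] (s : ℕ) :
    LinearIndependent (ZMod p) fun w : lyndonWords X s =>
      (1 : ZMod p) ⊗ₜ[ℤ] wordClass s w.1 := by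
  classical
  rw [linearIndependent_iff']
  intro t g hg
  by_contra! hne
  obtain ⟨i, hi, hgi⟩ := hne
  obtain ⟨m, hm, hmax⟩ := Finset.exists_max_image (t.filter fun i => g i ≠ 0) id
    ⟨i, Finset.mem_filter.2 ⟨hi, hgi⟩⟩
  obtain ⟨hmt, hgm⟩ := Finset.mem_filter.1 hm
  obtain ⟨hp, hlead⟩ := m.2.1.lyndonSeries_spec
  obtain ⟨φ, hφ⟩ := hp.exists_linearMap p s
  have h := congrArg φ hg
  rw [map_sum, map_zero, Finset.sum_eq_single m, map_smul, hφ _ m.2.2, hlead.1] at h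
  · exact hgm (by simpa using h)
  · intro j hj hjm
    rw [map_smul, hφ _ j.2.2]
    by_cases hgj : g j = 0
    · rw [hgj, zero_smul]
    · have hjle : j ≤ m := hmax j (Finset.mem_filter.2 ⟨hj, hgj⟩)
      have : lyndonSeries m.1 j.1 = 0 := by
        by_contra h0
        exact hjm (le_antisymm hjle (hlead.2 _ h0).2)
      rw [this, Int.cast_zero, smul_zero]
  · exact fun h => absurd hmt h

end Module

/-! ### Counting Lyndon words -/

section Counting

variable {X : Type*}

/-- The `k`-th power of a word. -/
abbrev wordPow (l : List X) (k : ℕ) : List X := (List.replicate k l).flatten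

theorem length_wordPow (l : List X) (k : ℕ) : (wordPow l k).length = k * l.length := by
  simp [wordPow]

theorem wordPow_rotate_length (l : List X) (k : ℕ) :
    (wordPow l k).rotate l.length = wordPow l k := by
  cases k with
  | zero => simp [wordPow]
  | succ k =>
    rw [wordPow, List.replicate_succ, List.flatten_cons, List.rotate_append_length_eq,
      append_flatten_comm fun m hm => List.eq_of_mem_replicate hm]

theorem wordPow_rotate_mod (l : List X) (k i : ℕ) :
    (wordPow l k).rotate (i % l.length) = (wordPow l k).rotate i := by
  have h (q : ℕ) : (wordPow l k).rotate (l.length * q) = wordPow l k := by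
    induction q with
    | zero => simp
    | succ q ih => rw [Nat.mul_succ, ← List.rotate_rotate, ih, wordPow_rotate_length]
  conv_rhs => rw [← Nat.div_add_mod i l.length, ← List.rotate_rotate, h]

theorem ncard_words [Finite X] (n : ℕ) : {w : List X | w.length = n}.ncard = Nat.card X ^ n := by
  cases nonempty_fintype X
  rw [Nat.card_eq_fintype_card, ← card_vector (α := X) n, ← Nat.card_eq_fintype_card]
  rfl

variable [LinearOrder X]

/-- The rotation begins with a proper suffix of `l`, which exceeds `l` and is shorter, so the
comparison is settled within it. -/
theorem IsLyndon.wordPow_lt_rotate {l : List X} (hl : IsLyndon l) {k i : ℕ} (hk : 0 < k)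
    (hi : 0 < i) (hil : i < l.length) : wordPow l k < (wordPow l k).rotate i := by
  obtain ⟨k, rfl⟩ := Nat.exists_eq_succ_of_ne_zero hk.ne'
  set r := wordPow l k with hr
  have hz : wordPow l (k + 1) = l ++ r := by
    rw [wordPow, List.replicate_succ, List.flatten_cons]
  rw [Nat.succ_eq_add_one, hz]
  have hlen : (l.take i).length = i := by rw [List.length_take]; omega
  have hrot : (l ++ r).rotate i = l.drop i ++ (r ++ l.take i) := by
    conv_lhs => rw [← List.take_append_drop i l, List.append_assoc]
    conv_lhs => enter [2]; rw [← hlen]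
    rw [List.rotate_append_length_eq, List.append_assoc]
  rw [hrot]
  have h1 : (l.drop i).length = l.length - i := List.length_drop
  refine append_lt_append_of_length_le (hl.2 _ (List.drop_suffix i l) ?_ ?_) (by omega) _ _
  · exact List.length_pos_iff.1 (by omega)
  · intro h
    rw [h] at h1
    omega

theorem IsLyndon.wordPow_le_rotate {l : List X} (hl : IsLyndon l) {k : ℕ} (hk : 0 < k) (i : ℕ) :
    wordPow l k ≤ (wordPow l k).rotate i := by
  rw [← wordPow_rotate_mod]
  rcases Nat.eq_zero_or_pos (i % l.length) with h | h
  · rw [h, List.rotate_zero]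
  · exact (hl.wordPow_lt_rotate hk h (Nat.mod_lt _ (List.length_pos_iff.2 hl.1))).le

/-- Both powers are the least element of the same rotation class, hence equal. The length of a
strictly shorter base would be a period of the power of the longer one, against
`IsLyndon.wordPow_lt_rotate`; that lemma also separates the rotations. -/
theorem IsLyndon.eq_of_wordPow_rotate_eq {l l' : List X} (hl : IsLyndon l) (hl' : IsLyndon l')
    {k k' i i' : ℕ} (hk : 0 < k) (hk' : 0 < k') (hi : i < l.length) (hi' : i' < l'.length)
    (h : (wordPow l k).rotate i = (wordPow l' k').rotate i') : l = l' ∧ i = i' := by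
  have hrot : wordPow l k ~r wordPow l' k' :=
    (List.IsRotated.forall _ i).symm.trans (h ▸ List.IsRotated.forall _ i')
  have hz : wordPow l k = wordPow l' k' := by
    obtain ⟨n', hn'⟩ := hrot.symm
    obtain ⟨n, hn⟩ := hrot
    exact le_antisymm (hn ▸ hl.wordPow_le_rotate hk n) (hn' ▸ hl'.wordPow_le_rotate hk' n')
  have hle {l l' : List X} (hl : IsLyndon l) (hl' : IsLyndon l') {k k' : ℕ} (hk' : 0 < k')
      (hz : wordPow l k = wordPow l' k') : l'.length ≤ l.length := by
    by_contra! hlt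
    have := hl'.wordPow_lt_rotate hk' (List.length_pos_iff.2 hl.1) hlt
    rw [← hz, wordPow_rotate_length] at this
    exact lt_irrefl _ this
  have hlen := le_antisymm (hle hl' hl hk hz.symm) (hle hl hl' hk' hz)
  have hll : l = l' := by
    obtain ⟨k, rfl⟩ := Nat.exists_eq_succ_of_ne_zero hk.ne'
    obtain ⟨k', rfl⟩ := Nat.exists_eq_succ_of_ne_zero hk'.ne'
    rw [wordPow, wordPow, List.replicate_succ, List.replicate_succ, List.flatten_cons,
      List.flatten_cons] at hz
    exact (List.append_inj hz hlen).1
  subst hll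
  refine ⟨rfl, ?_⟩
  rw [← hz] at h
  have key {i j : ℕ} (hj : j < l.length) (hij : i < j) :
      (wordPow l k).rotate i ≠ (wordPow l k).rotate j := by
    intro h
    obtain ⟨d, rfl⟩ := Nat.exists_eq_add_of_lt hij
    rw [show i + d + 1 = (d + 1) + i by ring, ← List.rotate_rotate, List.rotate_eq_rotate] at h
    exact (hl.wordPow_lt_rotate hk (Nat.succ_pos d) (by omega)).ne h
  rcases lt_trichotomy i i' with h' | h' | h'
  · exact absurd h (key hi' h')
  · exact h'
  · exact absurd h.symm (key hi h')

/-- Rotating the last Lyndon factor to the front would give a smaller word if the first factor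
exceeded it. So the first and last factors agree, and by monotonicity all do. -/
theorem exists_wordPow_of_le_rotate (z : List X) (h0 : z ≠ []) (hz : ∀ i, z ≤ z.rotate i) :
    ∃ l k, IsLyndon l ∧ 0 < k ∧ wordPow l k = z := by
  obtain ⟨M, v, hL, hM, rfl, -⟩ := exists_lyndon_factorization _ z le_rfl h0
  have hv : IsLyndon v := hL v (by simp)
  have hrot := hz M.flatten.length
  rw [List.rotate_append_length_eq] at hrot
  have hall : ∀ m ∈ M, m = v := by
    cases M with
    | nil => simp
    | cons m M =>
      rw [List.cons_append, List.pairwise_cons] at hM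
      have hvm : v ≤ m := hM.1 v (by simp)
      have hm : IsLyndon m := hL m (by simp)
      have hmv : m = v := by
        by_contra hne
        have hlt : v < m := lt_of_le_of_ne hvm (Ne.symm hne)
        refine not_lt.2 hrot ?_
        rw [List.flatten_cons, List.append_assoc]
        by_cases hp : v <+: m
        · obtain ⟨y, rfl⟩ := hp
          have hy : y ≠ [] := by rintro rfl; simp at hne
          have hlen : (v ++ y).length = v.length + y.length := List.length_append
          have hv0 := List.length_pos_iff.2 hv.1
          have h1 : v ++ y < y := hm.2 y (List.suffix_append v y) hy fun h => by
            rw [← h] at hlen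
            omega
          rw [List.append_assoc v y (M.flatten ++ v), append_lt_append_iff_right]
          exact append_lt_append_of_length_le h1 (by omega) _ _
        · exact append_lt_append_of_not_prefix hlt hp _ _
      intro x hx
      rcases List.mem_cons.1 hx with rfl | hx
      · exact hmv
      · exact le_antisymm ((hM.1 x (by simp [hx])).trans hmv.le)
          ((List.pairwise_append.1 hM.2).2.2 x hx v (by simp))
  refine ⟨v, M.length + 1, hv, Nat.succ_pos _, ?_⟩
  rw [wordPow, List.replicate_succ, List.flatten_cons, List.eq_replicate_of_mem hall,
    List.length_replicate,
    append_flatten_comm fun m hm => List.eq_of_mem_replicate hm]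

theorem exists_wordPow_rotate (w : List X) (h0 : w ≠ []) :
    ∃ l k i, IsLyndon l ∧ 0 < k ∧ i < l.length ∧ (wordPow l k).rotate i = w := by
  obtain ⟨z, hzw, hz⟩ : ∃ z, z ~r w ∧ ∀ i, z ≤ z.rotate i := by
    have hne : (w.cyclicPermutations.toFinset).Nonempty :=
      ⟨w, by simp [List.mem_cyclicPermutations_iff, List.IsRotated.refl]⟩
    obtain ⟨z, hz, hmin⟩ := Finset.exists_min_image _ id hne
    rw [List.mem_toFinset, List.mem_cyclicPermutations_iff] at hz
    refine ⟨z, hz, fun i => hmin _ ?_⟩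
    rw [List.mem_toFinset, List.mem_cyclicPermutations_iff]
    exact (List.IsRotated.forall z i).trans hz
  have hz0 : z ≠ [] := by
    rintro rfl
    exact h0 (List.isRotated_nil_iff'.1 hzw).symm
  obtain ⟨l, k, hl, hk, rfl⟩ := exists_wordPow_of_le_rotate z hz0 hz
  obtain ⟨n, rfl⟩ := hzw
  exact ⟨l, k, n % l.length, hl, hk, Nat.mod_lt _ (List.length_pos_iff.2 hl.1),
    wordPow_rotate_mod l k n⟩

theorem finite_lyndonWords [Finite X] (s : ℕ) : (lyndonWords X s).Finite :=
  (List.finite_length_eq X s).subset fun _ hw => hw.2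

/-- Every word is in a unique way a rotation of a power of a Lyndon word. -/
theorem sum_divisors_mul_ncard_lyndonWords [Finite X] {n : ℕ} (hn : 0 < n) :
    ∑ d ∈ n.divisors, d * (lyndonWords X d).ncard = Nat.card X ^ n := by
  classical
  rw [← ncard_words (X := X) n, Set.ncard_eq_toFinset_card _ (List.finite_length_eq X n)]
  have hs : ∑ d ∈ n.divisors, d * (lyndonWords X d).ncard =
      (n.divisors.sigma fun d =>
        (finite_lyndonWords (X := X) d).toFinset ×ˢ Finset.range d).card := by
    rw [Finset.card_sigma]
    refine Finset.sum_congr rfl fun d _ => ?_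
    rw [Finset.card_product, Finset.card_range, mul_comm,
      Set.ncard_eq_toFinset_card _ (finite_lyndonWords (X := X) d)]
  rw [hs]
  refine Finset.card_bij (fun x _ => (wordPow x.2.1 (n / x.1)).rotate x.2.2) ?_ ?_ ?_
  · rintro ⟨d, l, i⟩ h
    simp only [Finset.mem_sigma, Nat.mem_divisors, Finset.mem_product, Set.Finite.mem_toFinset,
      Finset.mem_range] at h
    obtain ⟨⟨hd, -⟩, ⟨hl, hlen⟩, hi⟩ := h
    simp only [Set.Finite.mem_toFinset, Set.mem_ofPred_eq, List.length_rotate]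
    rw [length_wordPow, hlen, Nat.div_mul_cancel hd]
  · rintro ⟨d, l, i⟩ h ⟨d', l', i'⟩ h' heq
    simp only [Finset.mem_sigma, Nat.mem_divisors, Finset.mem_product, Set.Finite.mem_toFinset,
      Finset.mem_range] at h h'
    obtain ⟨⟨hd, -⟩, ⟨hl, rfl⟩, hi⟩ := h
    obtain ⟨⟨hd', -⟩, ⟨hl', rfl⟩, hi'⟩ := h'
    obtain ⟨rfl, rfl⟩ := hl.eq_of_wordPow_rotate_eq hl' (Nat.div_pos (Nat.le_of_dvd hn hd)
      (List.length_pos_iff.2 hl.1)) (Nat.div_pos (Nat.le_of_dvd hn hd')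
      (List.length_pos_iff.2 hl'.1)) hi hi' heq
    rfl
  · intro w hw
    simp only [Set.Finite.mem_toFinset, Set.mem_ofPred_eq] at hw
    obtain ⟨l, k, i, hl, hk, hi, rfl⟩ :=
      exists_wordPow_rotate w (List.length_pos_iff.1 (hw ▸ hn))
    rw [List.length_rotate, length_wordPow] at hw
    have hl0 := List.length_pos_iff.2 hl.1
    refine ⟨⟨l.length, l, i⟩, ?_, ?_⟩
    · simp only [Finset.mem_sigma, Nat.mem_divisors, Finset.mem_product,
        Set.Finite.mem_toFinset, Finset.mem_range]
      exact ⟨⟨⟨k, by rw [← hw, mul_comm]⟩, hn.ne'⟩, ⟨hl, rfl⟩, hi⟩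
    · simp only
      rw [← hw, Nat.mul_div_cancel _ hl0]

theorem ncard_lyndonWords [Finite X] {s : ℕ} (hs : 0 < s) :
    ((lyndonWords X s).ncard : ℚ) = (1 / (s : ℚ)) *
      ∑ d ∈ s.divisors, (ArithmeticFunction.moebius d : ℚ) * (Nat.card X : ℚ) ^ (s / d) := by
  have h := (ArithmeticFunction.sum_eq_iff_sum_mul_moebius_eq
    (f := fun n => (n : ℚ) * (lyndonWords X n).ncard) (g := fun n => (Nat.card X : ℚ) ^ n)).1
    (fun n hn => by exact_mod_cast sum_divisors_mul_ncard_lyndonWords (X := X) hn) s hs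
  rw [Nat.sum_divisorsAntidiagonal
    (f := fun a b => (ArithmeticFunction.moebius a : ℚ) * (Nat.card X : ℚ) ^ b)] at h
  rw [h]
  field_simp

theorem isLyndon_replicate_append {a b : X} (hab : a < b) (k : ℕ) :
    IsLyndon (List.replicate k a ++ [b]) := by
  induction k with
  | zero =>
    refine isLyndon_of_le_suffix (by simp) fun x hx h0 => ?_
    rcases List.suffix_cons_iff.1 hx with h | h
    · exact h.ge
    · exact absurd (List.suffix_nil.1 h) h0
  | succ k ih =>
    rw [List.replicate_succ, List.cons_append]
    have h1 : a :: (List.replicate k a ++ [b]) < List.replicate k a ++ [b] := by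
      rw [← List.cons_append, ← List.replicate_succ, List.replicate_succ', List.append_assoc,
        append_lt_append_iff_right]
      exact List.cons_lt_cons_iff.2 (Or.inl hab)
    refine ⟨by simp, fun x hx h0 hne => ?_⟩
    exact h1.trans_le (ih.le_suffix ((List.suffix_cons_iff.1 hx).resolve_left hne) h0)

theorem infinite_lyndonWords [Infinite X] {s : ℕ} (hs : 0 < s) : (lyndonWords X s).Infinite := by
  obtain ⟨k, rfl⟩ := Nat.exists_eq_succ_of_ne_zero hs.ne'
  obtain ⟨c⟩ : Nonempty X := inferInstance
  rcases Nat.eq_zero_or_pos k with rfl | hk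
  · refine Set.infinite_of_injective_forall_mem (f := fun x : X => [x]) (fun x y h => by simpa using h) ?_
    intro x
    refine ⟨isLyndon_of_le_suffix (by simp) fun y hy h0 => ?_, rfl⟩
    rcases List.suffix_cons_iff.1 hy with h | h
    · exact h.ge
    · exact absurd (List.suffix_nil.1 h) h0
  · have hinf : ({c}ᶜ : Set X).Infinite := (Set.finite_singleton c).infinite_compl
    -- For fixed `c`, the minimum and maximum of `x` and `c` determine `x`; this needs no infinite
    -- supply of letters on a given side of `c`.
    refine (hinf.image (f := fun x => List.replicate k (min x c) ++ [max x c]) ?_).mono ?_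
    · intro x _ y _ h
      obtain ⟨h1, h2⟩ := List.append_inj' h rfl
      have h3 : min x c = min y c := by
        simpa [hk.ne'] using h1
      have h4 : max x c = max y c := by simpa using h2
      exact eq_of_inf_eq_sup_eq h3 h4
    · rintro _ ⟨x, hx, rfl⟩
      exact ⟨isLyndon_replicate_append (min_lt_max.2 hx) k, by simp⟩

end Counting

/-! ### Dimension and necklace formula -/

section Main

variable {X : Type*} [LinearOrder X] {s : ℕ}

theorem toENat_rank_indecDeg (p : ℕ) [Fact p.Prime] (hs : 1 ≤ s) (hsp : s < p) :
    Cardinal.toENat (Module.rank (ZMod p) (ZMod p ⊗[ℤ] indecDeg X s)) =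
      (lyndonWords X s).encard := by
  have hli := linearIndependent_tmul_lyndonWords (X := X) p s
  rcases finite_or_infinite X with hX | hX
  · have hb := (Module.Basis.mk hli (span_range_tmul_lyndonWords p hs hsp).ge).mk_eq_rank''
    rw [← hb]
    rfl
  -- Over an infinite alphabet independence alone makes the rank infinite.
  · rw [(infinite_lyndonWords hs).encard_eq, eq_top_iff,
      ← (infinite_lyndonWords (X := X) hs).encard_eq]
    exact OrderHomClass.mono Cardinal.toENat hli.cardinal_le_rank

theorem encard_lyndonWords (hs : 1 ≤ s) :
    (lyndonWords X s).encard.map (fun k : ℕ => (k : ℚ)) = necklace s (ENat.card X) := by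
  rcases finite_or_infinite X with hX | hX
  · rw [← (finite_lyndonWords (X := X) s).cast_ncard_eq, ENat.card_eq_coe_natCard]
    exact congrArg ((↑) : ℚ → WithTop ℚ) (ncard_lyndonWords hs)
  · rw [(infinite_lyndonWords hs).encard_eq, ENat.card_eq_top_of_infinite]
    rfl

end Main

end ShuffleAlgebra

/-- Every set carries a linear order and the first equality does not mention it, so that equality
holds for unordered alphabets. -/
theorem corollary7p4 {X : Type*} [Nonempty X] [LinearOrder X] (p : ℕ) (hp : p.Prime)
    (s : ℕ) (hs : 1 ≤ s) (hsp : s < p) :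
    (Cardinal.toENat (Module.rank (ZMod p) (ZMod p ⊗[ℤ] ShuffleAlgebra.indecDeg X s))).map
        (fun k : ℕ => (k : ℚ)) = ShuffleAlgebra.necklace s (ENat.card X) ∧
      (ShuffleAlgebra.lyndonWords X s).encard.map (fun k : ℕ => (k : ℚ)) =
        ShuffleAlgebra.necklace s (ENat.card X) := by
  have : Fact p.Prime := ⟨hp⟩
  rw [ShuffleAlgebra.toENat_rank_indecDeg p hs hsp]
  exact ⟨ShuffleAlgebra.encard_lyndonWords hs, ShuffleAlgebra.encard_lyndonWords hs⟩
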